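/- Let $a\ge b>0$ and $a',b'>0$ with $a'<a$ and $a^2-b^2=a'^2-b'^2$, and consider the confocal ellipses $\mathcal E:\ x^2/a^2+y^2/b^2=1$ and $\mathcal E':\ x^2/a'^2+y^2/b'^2=1$ (for $a=b$, two concentric circles). A 3-periodic of the pair is a nondegenerate triangle $P_1P_2P_3$ whose vertices lie on $\mathcal E$ and whose three side lines are tangent to $\mathcal E'$. For such a triangle let $r$ and $R$ be its inradius and circumradius, let $\rho=r/R$, let $\Omega_i$ be the area of the excircle opposite to $P_i$, and let $\Delta_i$ be the area of the circumellipse (the ellipse through $P_1,P_2,P_3$) centered at the center of that excircle; for each $i$ this ellipse exists and is unique. Then $$\frac{\Delta_1}{\Omega_1}+\frac{\Delta_2}{\Omega_2}+\frac{\Delta_3}{\Omega_3}=\frac{2}{\rho}=\frac{2R}{r},$$ and this quantity is invariant over the family: it takes the same value for all 3-periodics of a given pair $(\mathcal E,\mathcal E')$. -/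

import Mathlib

open MeasureTheory

namespace PonceletConfocal

/-- The Euclidean plane. -/
abbrev Plane := EuclideanSpace ℝ (Fin 2)

/-- An ellipse in arbitrary position, `{x | (x - c)ᵀ M (x - c) = 1}` with centre `c` and `M`
symmetric positive definite (circles included); `c` and `M` are determined by the curve. -/
structure Ellipse where
  center : Plane
  form : Matrix (Fin 2) (Fin 2) ℝ
  posDef : form.PosDef

namespace Ellipse

/-- The value of `(x - c)ᵀ M (x - c)`. -/
noncomputable def eval (E : Ellipse) (x : Plane) : ℝ :=
  (x - E.center).ofLp ⬝ᵥ E.form.mulVec (x - E.center).ofLp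

/-- The points on the ellipse. -/
def curve (E : Ellipse) : Set Plane := {x | E.eval x = 1}

/-- The closed region bounded by the ellipse. -/
def region (E : Ellipse) : Set Plane := {x | E.eval x ≤ 1}

/-- The area enclosed by the ellipse (Lebesgue measure of its region). -/
noncomputable def area (E : Ellipse) : ℝ := volume.real E.region

/-- `E` is a circumellipse of the triangle `T`: it passes through the three vertices. -/
def IsCircumellipse (E : Ellipse) (T : Affine.Triangle ℝ Plane) : Prop :=
  ∀ j, T.points j ∈ E.curve

end Ellipse

/-- The ellipse `x² / a² + y² / b² = 1`. -/
def axisEllipse (a b : ℝ) : Set Plane := {x | x 0 ^ 2 / a ^ 2 + x 1 ^ 2 / b ^ 2 = 1}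

/-- The line `PQ` is tangent to the ellipse `S`, i.e. meets it in exactly one point. -/
def LineTangent (P Q : Plane) (S : Set Plane) : Prop :=
  ∃! X : Plane, X ∈ line[ℝ, P, Q] ∧ X ∈ S

/-- The (nondegenerate) triangle `T` is interscribed between `S` and `S'`: its vertices lie on `S`
and its three side lines are tangent to `S'`. -/
def IsInterscribed (T : Affine.Triangle ℝ Plane) (S S' : Set Plane) : Prop :=
  (∀ i, T.points i ∈ S) ∧ ∀ i j, i ≠ j → LineTangent (T.points i) (T.points j) S'

/-- The excenter of `T` opposite to the vertex `i`: the centre of the circle tangent to the three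
side lines and separated from vertex `i` by the opposite side. -/
noncomputable def excenter (T : Affine.Triangle ℝ Plane) (i : Fin 3) : Plane :=
  Affine.Simplex.excenter T {i}

/-- The area of the disk bounded by the excircle of `T` opposite to the vertex `i`. -/
noncomputable def excircleArea (T : Affine.Triangle ℝ Plane) (i : Fin 3) : ℝ :=
  volume.real (Metric.closedBall (excenter T i) (Affine.Simplex.exradius T {i}))

/-- The ratio `ρ = r / R` of the inradius to the circumradius. -/
noncomputable def rho (T : Affine.Triangle ℝ Plane) : ℝ :=
  Affine.Simplex.inradius T / Affine.Simplex.circumradius T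

end PonceletConfocal

namespace PonceletConfocal

/-! Let `s_i` be the sides, `D` twice the signed area and `N_i = s_j + s_k - s_i`. The excenter
opposite to vertex `i` has barycentric coordinates `(-s_i : s_j : s_k)`, and the exradius is `|D| /
N_i`. A quadratic form equal to 1 at the three vertices, seen from a centre with given barycentrics,
is determined by its Gram matrix on two of them; at an excenter the Gram determinant is controlled
by Heron's formula, and the ellipse has area `π s_0 s_1 s_2 / N_i`
(`existsUnique_circumellipse_excenter`). Each ratio is therefore `s_0 s_1 s_2 N_i / D²`. Since the
`N_i` add up to the perimeter, the sum is `(∏ s)(∑ s) / D² = 2R / r`.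

For invariance, scale the outer ellipse to the unit circle and put `l = a² - a'²`. If `g` is the
inner product of the scaled ends of a side, tangency gives the length `(a b / √l)(1 - g)`
(`chord_data`), while `D² = 2 a² b² ∏ (1 - g)` (`area_unit_circle`). The products cancel and only `∑
(1 - g)` remains. Tangency also says that the scaled vertices are pairwise conjugate for a fixed
conic, which fixes that sum (`closing`). -/

/-- The determinant of two plane vectors. -/
def cross (v w : Plane) : ℝ := v 0 * w 1 - v 1 * w 0

lemma dist_sq (x y : Plane) : dist x y ^ 2 = (x 0 - y 0) ^ 2 + (x 1 - y 1) ^ 2 := by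
  rw [EuclideanSpace.dist_eq, Real.sq_sqrt (by positivity), Fin.sum_univ_two]
  simp [Real.dist_eq, sq_abs]

/-! ### Area of an ellipse -/

namespace Ellipse

variable (E : Ellipse)

lemma form_symm : E.form 1 0 = E.form 0 1 := by
  simpa using E.posDef.isHermitian.apply 0 1

lemma eval_eq (x : Plane) : E.eval x = E.form 0 0 * (x 0 - E.center 0) ^ 2
    + 2 * E.form 0 1 * (x 0 - E.center 0) * (x 1 - E.center 1)
    + E.form 1 1 * (x 1 - E.center 1) ^ 2 := by
  simp only [eval, dotProduct, Matrix.mulVec, Fin.sum_univ_two, WithLp.ofLp_sub, Pi.sub_apply,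
    E.form_symm]
  ring

lemma form_zero_zero_pos : 0 < E.form 0 0 := E.posDef.diag_pos

lemma det_form_eq : E.form.det = E.form 0 0 * E.form 1 1 - E.form 0 1 ^ 2 := by
  rw [Matrix.det_fin_two, E.form_symm]; ring

/-- A linear map carrying the form of an ellipse to the Euclidean one. -/
noncomputable def toDisk : Plane →ₗ[ℝ] Plane :=
  Matrix.toLin (EuclideanSpace.basisFun (Fin 2) ℝ).toBasis (EuclideanSpace.basisFun (Fin 2) ℝ).toBasis
    -- The Cholesky factor `L`, with `Lᵀ L` equal to the form.
    !![√(E.form 0 0), E.form 0 1 / √(E.form 0 0); 0, √(E.form.det / E.form 0 0)]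

lemma toDisk_apply_zero (x : Plane) :
    E.toDisk x 0 = √(E.form 0 0) * x 0 + E.form 0 1 / √(E.form 0 0) * x 1 := by
  simp [toDisk, Matrix.toLin_apply, Matrix.mulVec, dotProduct, Fin.sum_univ_two]

lemma toDisk_apply_one (x : Plane) : E.toDisk x 1 = √(E.form.det / E.form 0 0) * x 1 := by
  simp [toDisk, Matrix.toLin_apply, Matrix.mulVec, dotProduct, Fin.sum_univ_two]

lemma det_toDisk : LinearMap.det E.toDisk = √E.form.det := by
  rw [toDisk, LinearMap.det_toLin, Matrix.det_fin_two_of, mul_zero, sub_zero,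
    ← Real.sqrt_mul E.form_zero_zero_pos.le, mul_div_cancel₀ _ E.form_zero_zero_pos.ne']

lemma region_eq : E.region =
    (fun x => x - E.center) ⁻¹' (E.toDisk ⁻¹' Metric.closedBall 0 1) := by
  ext x
  have h0 := E.form_zero_zero_pos
  have hs : √(E.form 0 0) ^ 2 = E.form 0 0 := Real.sq_sqrt h0.le
  have hs' : √(E.form 0 0) ≠ 0 := (Real.sqrt_pos.2 h0).ne'
  have hd : √(E.form.det / E.form 0 0) ^ 2 = E.form.det / E.form 0 0 :=
    Real.sq_sqrt (div_nonneg E.posDef.det_pos.le h0.le)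
  have key : E.eval x = dist (E.toDisk (x - E.center)) 0 ^ 2 := by
    rw [dist_sq, toDisk_apply_zero, toDisk_apply_one, eval_eq]
    simp only [PiLp.sub_apply, PiLp.zero_apply, sub_zero]
    rw [mul_pow √(E.form.det / E.form 0 0), hd, add_sq, mul_pow, hs, mul_pow, div_pow, hs,
      det_form_eq]
    field_simp
    ring
  simp only [region, Set.mem_ofPred_eq, Set.mem_preimage, Metric.mem_closedBall, key]
  exact sq_le_one_iff₀ dist_nonneg

theorem area_eq : E.area = Real.pi / √E.form.det := by
  have hd : 0 < √E.form.det := Real.sqrt_pos.2 E.posDef.det_pos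
  rw [area, region_eq, Measure.real, show (fun x => x - E.center) = fun x => x + -E.center from funext fun x => sub_eq_add_neg _ _,
    measure_preimage_add_right,
    Measure.addHaar_preimage_linearMap _ (by rw [det_toDisk]; exact hd.ne'), det_toDisk,
    EuclideanSpace.volume_closedBall_fin_two]
  simp [abs_of_pos hd, ENNReal.toReal_ofReal, hd.le, Real.pi_pos.le]
  field_simp

end Ellipse

/-! ### Ellipses through three points with a prescribed centre -/

/-- A symmetric `2 × 2` matrix with positive top left entry and positive determinant is positive
definite. -/
lemma posDef_fin_two {p q r : ℝ} (hp : 0 < p) (hd : 0 < p * r - q ^ 2) :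
    (!![p, q; q, r] : Matrix (Fin 2) (Fin 2) ℝ).PosDef := by
  rw [Matrix.posDef_iff_dotProduct_mulVec]
  refine ⟨by ext i j; fin_cases i <;> fin_cases j <;> rfl, fun x hx => ?_⟩
  simp only [dotProduct, Matrix.mulVec, Fin.sum_univ_two, Pi.star_apply, star_trivial,
    Matrix.of_apply, Matrix.cons_val_zero, Matrix.cons_val_one]
  have h : p * (x 0 * (p * x 0 + q * x 1) + x 1 * (q * x 0 + r * x 1))
      = (p * x 0 + q * x 1) ^ 2 + (p * r - q ^ 2) * x 1 ^ 2 := by ring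
  refine pos_of_mul_pos_right (a := p) ?_ hp.le
  rw [h]
  by_cases h1 : x 1 = 0
  · have h0 : x 0 ≠ 0 := fun h0 => hx (by ext i; fin_cases i <;> assumption)
    rw [h1]; simp only [mul_zero, add_zero]; positivity
  · positivity

/-- If `u v₀ + v v₁ + w v₂ = 0` with nonzero coefficients, the quadratic forms taking the value `1`
at the three vectors are exactly the one given by an explicit formula. -/
lemma form_iff {x₀ y₀ x₁ y₁ x₂ y₂ u v w p q r : ℝ} (hu : u ≠ 0) (hv : v ≠ 0) (hw : w ≠ 0)
    (hx : u * x₀ + v * x₁ + w * x₂ = 0) (hy : u * y₀ + v * y₁ + w * y₂ = 0)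
    (hδ : x₁ * y₂ - y₁ * x₂ ≠ 0) {g : ℝ} (hg : 2 * v * w * g = u ^ 2 - v ^ 2 - w ^ 2) :
    (p * x₀ ^ 2 + 2 * q * x₀ * y₀ + r * y₀ ^ 2 = 1 ∧ p * x₁ ^ 2 + 2 * q * x₁ * y₁ + r * y₁ ^ 2 = 1 ∧
      p * x₂ ^ 2 + 2 * q * x₂ * y₂ + r * y₂ ^ 2 = 1) ↔
    p = (y₂ ^ 2 - 2 * g * y₁ * y₂ + y₁ ^ 2) / (x₁ * y₂ - y₁ * x₂) ^ 2 ∧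
    q = (-x₂ * y₂ + g * (x₁ * y₂ + y₁ * x₂) - x₁ * y₁) / (x₁ * y₂ - y₁ * x₂) ^ 2 ∧
    r = (x₂ ^ 2 - 2 * g * x₁ * x₂ + x₁ ^ 2) / (x₁ * y₂ - y₁ * x₂) ^ 2 := by
  have hδ2 : (x₁ * y₂ - y₁ * x₂) ^ 2 ≠ 0 := pow_ne_zero 2 hδ
  -- Evaluate the form at `u v₀ = -(v v₁ + w v₂)`. The values at the three vectors then force the
  -- polar form at `(v₁, v₂)` to be `g`, so its Gram matrix there is `[[1, g], [g, 1]]`.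
  have e0 : u ^ 2 * (p * x₀ ^ 2 + 2 * q * x₀ * y₀ + r * y₀ ^ 2) =
      v ^ 2 * (p * x₁ ^ 2 + 2 * q * x₁ * y₁ + r * y₁ ^ 2)
      + w ^ 2 * (p * x₂ ^ 2 + 2 * q * x₂ * y₂ + r * y₂ ^ 2)
      + 2 * v * w * (p * x₁ * x₂ + q * (x₁ * y₂ + y₁ * x₂) + r * y₁ * y₂) := by
    have hx' : u * x₀ = -(v * x₁ + w * x₂) := by linear_combination hx
    have hy' : u * y₀ = -(v * y₁ + w * y₂) := by linear_combination hy
    calc _ = p * (u * x₀) ^ 2 + 2 * q * (u * x₀) * (u * y₀) + r * (u * y₀) ^ 2 := by ring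
      _ = _ := by rw [hx', hy']; ring
  constructor
  · rintro ⟨h0, h1, h2⟩
    have h12 : p * x₁ * x₂ + q * (x₁ * y₂ + y₁ * x₂) + r * y₁ * y₂ = g := by
      rw [h0, h1, h2] at e0
      apply mul_left_cancel₀ (mul_ne_zero (mul_ne_zero two_ne_zero hv) hw)
      linear_combination -e0 - hg
    refine ⟨?_, ?_, ?_⟩ <;> rw [eq_div_iff hδ2]
    · linear_combination y₂ ^ 2 * h1 + y₁ ^ 2 * h2 - 2 * y₁ * y₂ * h12
    · linear_combination -x₂ * y₂ * h1 - x₁ * y₁ * h2 + (x₁ * y₂ + y₁ * x₂) * h12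
    · linear_combination x₂ ^ 2 * h1 + x₁ ^ 2 * h2 - 2 * x₁ * x₂ * h12
  · rintro ⟨hp, hq, hr⟩
    rw [eq_div_iff hδ2] at hp hq hr
    have h1 : p * x₁ ^ 2 + 2 * q * x₁ * y₁ + r * y₁ ^ 2 = 1 := by
      apply mul_right_cancel₀ hδ2
      linear_combination x₁ ^ 2 * hp + 2 * x₁ * y₁ * hq + y₁ ^ 2 * hr
    have h2 : p * x₂ ^ 2 + 2 * q * x₂ * y₂ + r * y₂ ^ 2 = 1 := by
      apply mul_right_cancel₀ hδ2
      linear_combination x₂ ^ 2 * hp + 2 * x₂ * y₂ * hq + y₂ ^ 2 * hr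
    have h12 : p * x₁ * x₂ + q * (x₁ * y₂ + y₁ * x₂) + r * y₁ * y₂ = g := by
      apply mul_right_cancel₀ hδ2
      linear_combination x₁ * x₂ * hp + (x₁ * y₂ + y₁ * x₂) * hq + y₁ * y₂ * hr
    refine ⟨?_, h1, h2⟩
    rw [h1, h2, h12] at e0
    apply mul_left_cancel₀ (pow_ne_zero 2 hu)
    linear_combination e0 + hg

/-- Data for an ellipse through three points centred at a point with barycentric coordinates
`(u : v : w)`. -/
lemma existsUnique_circumellipse {X P₀ P₁ P₂ : Plane} {u v w : ℝ}
    (hu : u ≠ 0) (hv : v ≠ 0) (hw : w ≠ 0)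
    (hX : u • (P₀ - X) + v • (P₁ - X) + w • (P₂ - X) = 0)
    (hδ : cross (P₁ - X) (P₂ - X) ≠ 0)
    (hH : 0 < (u + v + w) * (u + v - w) * (u - v + w) * (-u + v + w)) :
    (∃! C : Ellipse, C.center = X ∧ P₀ ∈ C.curve ∧ P₁ ∈ C.curve ∧ P₂ ∈ C.curve) ∧
    ∀ C : Ellipse, C.center = X → P₀ ∈ C.curve → P₁ ∈ C.curve → P₂ ∈ C.curve →
      C.form.det * (2 * v * w * cross (P₁ - X) (P₂ - X)) ^ 2 =
        (u + v + w) * (u + v - w) * (u - v + w) * (-u + v + w) := by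
  have hx : u * (P₀ 0 - X 0) + v * (P₁ 0 - X 0) + w * (P₂ 0 - X 0) = 0 := by
    simpa using congrArg (fun z : Plane => z 0) hX
  have hy : u * (P₀ 1 - X 1) + v * (P₁ 1 - X 1) + w * (P₂ 1 - X 1) = 0 := by
    simpa using congrArg (fun z : Plane => z 1) hX
  simp only [cross, PiLp.sub_apply] at hδ ⊢
  obtain ⟨g, hg⟩ : ∃ g, 2 * v * w * g = u ^ 2 - v ^ 2 - w ^ 2 :=
    ⟨(u ^ 2 - v ^ 2 - w ^ 2) / (2 * v * w), by field_simp⟩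
  have hiff := fun p q r : ℝ => form_iff (p := p) (q := q) (r := r) hu hv hw hx hy hδ hg
  -- The Gram determinant `1 - g²` factors into Heron's product, so `hH` is exactly what makes the
  -- conic an ellipse.
  have hgg : (2 * v * w) ^ 2 * (1 - g ^ 2) =
      (u + v + w) * (u + v - w) * (u - v + w) * (-u + v + w) := by
    linear_combination (-(2 * v * w * g) - (u ^ 2 - v ^ 2 - w ^ 2)) * hg
  have hg1 : 0 < 1 - g ^ 2 := by
    rw [← hgg] at hH
    exact pos_of_mul_pos_right hH (by positivity)
  generalize hx₁ : P₁ 0 - X 0 = x₁ at *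
  generalize hy₁ : P₁ 1 - X 1 = y₁ at *
  generalize hx₂ : P₂ 0 - X 0 = x₂ at *
  generalize hy₂ : P₂ 1 - X 1 = y₂ at *
  have hδ2 : 0 < (x₁ * y₂ - y₁ * x₂) ^ 2 := by positivity
  obtain ⟨p, hp⟩ : ∃ p, p = (y₂ ^ 2 - 2 * g * y₁ * y₂ + y₁ ^ 2) / (x₁ * y₂ - y₁ * x₂) ^ 2 :=
    ⟨_, rfl⟩
  obtain ⟨q, hq⟩ : ∃ q, q = (-x₂ * y₂ + g * (x₁ * y₂ + y₁ * x₂) - x₁ * y₁) /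
    (x₁ * y₂ - y₁ * x₂) ^ 2 := ⟨_, rfl⟩
  obtain ⟨r, hr⟩ : ∃ r, r = (x₂ ^ 2 - 2 * g * x₁ * x₂ + x₁ ^ 2) / (x₁ * y₂ - y₁ * x₂) ^ 2 :=
    ⟨_, rfl⟩
  rw [← hp, ← hq, ← hr] at hiff
  have hC : ∀ C : Ellipse, C.center = X → ((P₀ ∈ C.curve ∧ P₁ ∈ C.curve ∧ P₂ ∈ C.curve) ↔
      C.form 0 0 = p ∧ C.form 0 1 = q ∧ C.form 1 1 = r) := by
    rintro C rfl
    rw [← hiff]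
    simp only [Ellipse.curve, Set.mem_ofPred_eq, Ellipse.eval_eq, hx₁, hy₁, hx₂, hy₂]
  have hp0 : 0 < p := by
    rw [hp]
    apply div_pos _ hδ2
    have : y₂ ^ 2 - 2 * g * y₁ * y₂ + y₁ ^ 2 = (y₂ - g * y₁) ^ 2 + (1 - g ^ 2) * y₁ ^ 2 := by ring
    rw [this]
    by_cases h : y₁ = 0
    · have : y₂ ≠ 0 := by rintro h2; apply hδ; rw [h, h2]; ring
      rw [h]; simp only [mul_zero, sub_zero]; positivity
    · positivity
  -- The Gram determinant is the determinant of the form times the square of that of the basis.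
  have hdet : (p * r - q ^ 2) * (x₁ * y₂ - y₁ * x₂) ^ 2 = 1 - g ^ 2 := by
    rw [eq_div_iff hδ2.ne'] at hp hq hr
    apply mul_right_cancel₀ hδ2.ne'
    calc _ = (p * (x₁ * y₂ - y₁ * x₂) ^ 2) * (r * (x₁ * y₂ - y₁ * x₂) ^ 2) -
          (q * (x₁ * y₂ - y₁ * x₂) ^ 2) ^ 2 := by ring
      _ = _ := by rw [hp, hq, hr]; ring
  have hd0 : 0 < p * r - q ^ 2 := by
    rw [← hdet] at hg1
    exact pos_of_mul_pos_left hg1 hδ2.le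
  refine ⟨⟨⟨X, _, posDef_fin_two hp0 hd0⟩, ⟨rfl, (hC _ rfl).2 ⟨rfl, rfl, rfl⟩⟩, ?_⟩, ?_⟩
  · rintro C ⟨hc, h⟩
    obtain ⟨h1, h2, h3⟩ := (hC C hc).1 h
    have h4 := C.form_symm
    obtain ⟨c, M, hM⟩ := C
    obtain rfl : c = X := hc
    congr
    ext i j
    fin_cases i <;> fin_cases j
    exacts [h1, h2, h4.trans h2, h3]
  · intro C hc h₀ h₁ h₂
    obtain ⟨h1, h2, h3⟩ := (hC C hc).1 ⟨h₀, h₁, h₂⟩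
    rw [C.det_form_eq, h1, h2, h3, ← hgg, ← hdet]
    ring


/-! ### Sides, heights, radii and excenters of a triangle -/

lemma sum_fin_three_cyclic {M : Type*} [AddCommMonoid M] (f : Fin 3 → M) (i : Fin 3) :
    ∑ l, f l = f i + f (i + 1) + f (i + 2) := by
  rw [Fin.sum_univ_three]
  fin_cases i
  · rfl
  · change _ = f 1 + f 2 + f 0; abel
  · change _ = f 2 + f 0 + f 1; abel

lemma forall_fin_three_cyclic {p : Fin 3 → Prop} (i : Fin 3) :
    (∀ j, p j) ↔ p i ∧ p (i + 1) ∧ p (i + 2) := by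
  refine ⟨fun h => ⟨h _, h _, h _⟩, fun ⟨h0, h1, h2⟩ j => ?_⟩
  fin_cases i <;> fin_cases j <;> assumption

variable (T : Affine.Triangle ℝ Plane)

/-- The length of the side opposite to the vertex `i`. -/
noncomputable def side (i : Fin 3) : ℝ := dist (T.points (i + 1)) (T.points (i + 2))

/-- Twice the signed area of a triangle. -/
def doubleArea : ℝ := cross (T.points 1 - T.points 0) (T.points 2 - T.points 0)

lemma doubleArea_eq (i : Fin 3) :
    doubleArea T = cross (T.points (i + 1) - T.points i) (T.points (i + 2) - T.points i) := by
  fin_cases i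
  · rfl
  · change _ = cross (T.points 2 - T.points 1) (T.points 0 - T.points 1)
    simp only [doubleArea, cross, PiLp.sub_apply]; ring
  · change _ = cross (T.points 0 - T.points 2) (T.points 1 - T.points 2)
    simp only [doubleArea, cross, PiLp.sub_apply]; ring

lemma side_pos (i : Fin 3) : 0 < side T i :=
  dist_pos.2 (T.independent.injective.ne (by fin_cases i <;> decide))

lemma side_sq (i : Fin 3) : side T i ^ 2 = (T.points (i + 1) 0 - T.points (i + 2) 0) ^ 2 +
    (T.points (i + 1) 1 - T.points (i + 2) 1) ^ 2 := dist_sq _ _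

lemma height_mul_side (i : Fin 3) : T.height i * side T i = |doubleArea T| := by
  have h1 := T.inner_vsub_vsub_altitudeFoot_eq_height_sq (i := i) (j := i + 1)
    (by fin_cases i <;> decide)
  have h2 := T.inner_vsub_vsub_altitudeFoot_eq_height_sq (i := i) (j := i + 2)
    (by fin_cases i <;> decide)
  have h3 : T.height i ^ 2 = _ := dist_sq (T.points i) (T.altitudeFoot i)
  have hpos := T.height_pos i
  rw [doubleArea_eq T i, ← abs_of_pos (mul_pos hpos (side_pos T i)), ← sq_eq_sq_iff_abs_eq_abs,
    mul_pow, side_sq]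
  simp only [vsub_eq_sub, EuclideanSpace.inner_eq_star_dotProduct, dotProduct, Fin.sum_univ_two,
    Pi.star_apply, star_trivial, WithLp.ofLp_sub, Pi.sub_apply] at h1 h2
  simp only [cross, PiLp.sub_apply]
  generalize T.points i 0 - T.altitudeFoot i 0 = p at *
  generalize T.points i 1 - T.altitudeFoot i 1 = q at *
  generalize T.height i = h at *
  set D := (T.points (i + 1) 0 - T.points i 0) * (T.points (i + 2) 1 - T.points i 1) -
    (T.points (i + 1) 1 - T.points i 1) * (T.points (i + 2) 0 - T.points i 0) with hD
  -- Cramer's rule: `h1` and `h2` are linear equations for the altitude vector `(p, q)`.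
  have e1 : D * q = -(h ^ 2 * (T.points (i + 1) 0 - T.points (i + 2) 0)) := by
    rw [hD]
    linear_combination -(T.points i 0 - T.points (i + 2) 0) * h1 +
      (T.points i 0 - T.points (i + 1) 0) * h2
  have e2 : D * p = h ^ 2 * (T.points (i + 1) 1 - T.points (i + 2) 1) := by
    rw [hD]
    linear_combination (T.points i 1 - T.points (i + 2) 1) * h1 -
      (T.points i 1 - T.points (i + 1) 1) * h2
  apply mul_left_cancel₀ (pow_ne_zero 2 hpos.ne')
  calc _ = (-(h ^ 2 * (T.points (i + 1) 0 - T.points (i + 2) 0))) ^ 2 +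
      (h ^ 2 * (T.points (i + 1) 1 - T.points (i + 2) 1)) ^ 2 := by ring
    _ = (D * q) ^ 2 + (D * p) ^ 2 := by rw [e1, e2]
    _ = h ^ 2 * D ^ 2 := by rw [h3]; ring

lemma doubleArea_ne_zero : doubleArea T ≠ 0 := by
  rw [← abs_pos, ← height_mul_side T 0]
  exact mul_pos (T.height_pos 0) (side_pos T 0)

lemma inv_height_eq (i : Fin 3) : (T.height i)⁻¹ = side T i / |doubleArea T| := by
  have := (T.height_pos i).ne'
  have := (side_pos T i).ne'
  rw [← height_mul_side T i]
  field_simp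

/-- The perimeter of a triangle diminished by twice the side opposite to the vertex `i`. -/
noncomputable def excess (i : Fin 3) : ℝ := -side T i + side T (i + 1) + side T (i + 2)

lemma excenterWeightsUnnorm_self (i : Fin 3) :
    T.excenterWeightsUnnorm {i} i = -side T i / |doubleArea T| := by
  rw [Affine.Simplex.excenterWeightsUnnorm, if_pos (by simp), inv_height_eq]; ring

lemma excenterWeightsUnnorm_of_ne {i j : Fin 3} (h : j ≠ i) :
    T.excenterWeightsUnnorm {i} j = side T j / |doubleArea T| := by
  rw [Affine.Simplex.excenterWeightsUnnorm, if_neg (by simpa using h), inv_height_eq]; ring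

lemma add_one_ne (i : Fin 3) : i + 1 ≠ i := by fin_cases i <;> decide

lemma add_two_ne (i : Fin 3) : i + 2 ≠ i := by fin_cases i <;> decide

lemma sum_excenterWeightsUnnorm (i : Fin 3) :
    ∑ j, T.excenterWeightsUnnorm {i} j = excess T i / |doubleArea T| := by
  rw [sum_fin_three_cyclic _ i, excenterWeightsUnnorm_self,
    excenterWeightsUnnorm_of_ne T (add_one_ne i), excenterWeightsUnnorm_of_ne T (add_two_ne i),
    excess]
  ring

lemma excess_pos (i : Fin 3) : 0 < excess T i := by
  have h := T.sum_excenterWeightsUnnorm_singleton_pos i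
  rw [sum_excenterWeightsUnnorm] at h
  exact (div_pos_iff_of_pos_right (abs_pos.2 (doubleArea_ne_zero T))).1 h

lemma exradius_eq (i : Fin 3) : T.exradius {i} = |doubleArea T| / excess T i := by
  rw [Affine.Simplex.exradius_eq_abs_inv_sum, sum_excenterWeightsUnnorm, inv_div,
    abs_of_nonneg (div_nonneg (abs_nonneg _) (excess_pos T i).le)]

lemma inradius_eq : T.inradius = |doubleArea T| / ∑ i, side T i := by
  rw [Affine.Simplex.inradius_eq_abs_inv_sum]
  simp only [Affine.Simplex.excenterWeightsUnnorm_empty_apply, inv_height_eq]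
  rw [← Finset.sum_div, inv_div, abs_of_nonneg
    (div_nonneg (abs_nonneg _) (Finset.sum_nonneg fun i _ => (side_pos T i).le))]

/-- The excenter weights are the reciprocal heights with the sign at `i` reversed, and reciprocal
heights are proportional to the sides. -/
lemma excenter_relation (i : Fin 3) :
    (-side T i) • (T.points i - excenter T i) +
      side T (i + 1) • (T.points (i + 1) - excenter T i) +
      side T (i + 2) • (T.points (i + 2) - excenter T i) = 0 := by
  have hN := (excess_pos T i).ne'
  have hD := abs_ne_zero.2 (doubleArea_ne_zero T)
  have h1 := (T.excenterExists_singleton i).sum_excenterWeights_eq_one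
  have h := T.excenter_eq_affineCombination {i}
  rw [Finset.affineCombination_eq_linear_combination _ _ _ h1, sum_fin_three_cyclic _ i] at h
  simp only [Affine.Simplex.excenterWeights, Pi.smul_apply, sum_excenterWeightsUnnorm T i,
    excenterWeightsUnnorm_self T i, excenterWeightsUnnorm_of_ne T (add_one_ne i),
    excenterWeightsUnnorm_of_ne T (add_two_ne i), smul_eq_mul] at h
  have e : ∀ x : ℝ, (excess T i / |doubleArea T|)⁻¹ * (x / |doubleArea T|) = (excess T i)⁻¹ * x :=
    fun x => by field_simp
  simp only [e, mul_smul] at h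
  rw [← smul_add, ← smul_add] at h
  have h' : excess T i • excenter T i = -side T i • T.points i + side T (i + 1) • T.points (i + 1)
      + side T (i + 2) • T.points (i + 2) := by
    rw [excenter, h, smul_inv_smul₀ hN]
  simp only [smul_sub]
  rw [excess, add_smul, add_smul] at h'
  refine Eq.trans ?_ (sub_eq_zero.2 h'.symm)
  module

lemma excess_mul_cross (i : Fin 3) : excess T i *
    cross (T.points (i + 1) - excenter T i) (T.points (i + 2) - excenter T i) =
      -side T i * doubleArea T := by
  have h := excenter_relation T i
  have hx := congrArg (fun z : Plane => z 0) h
  have hy := congrArg (fun z : Plane => z 1) h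
  simp only [PiLp.add_apply, PiLp.smul_apply, PiLp.sub_apply, smul_eq_mul, PiLp.zero_apply]
    at hx hy
  rw [doubleArea_eq T i]
  simp only [cross, PiLp.sub_apply, excess]
  linear_combination (T.points (i + 2) 1 - T.points (i + 1) 1) * hx -
    (T.points (i + 2) 0 - T.points (i + 1) 0) * hy

lemma side_sq_cyclic_one (i : Fin 3) : side T (i + 1) ^ 2 =
    (T.points (i + 2) 0 - T.points i 0) ^ 2 + (T.points (i + 2) 1 - T.points i 1) ^ 2 := by
  rw [side_sq]; fin_cases i <;> rfl

lemma side_sq_cyclic_two (i : Fin 3) : side T (i + 2) ^ 2 =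
    (T.points i 0 - T.points (i + 1) 0) ^ 2 + (T.points i 1 - T.points (i + 1) 1) ^ 2 := by
  rw [side_sq]; fin_cases i <;> rfl

/-! ### Heron's formula, ellipses centred at excenters and the sum of ratios -/

/-- Heron's formula. -/
lemma heron (i : Fin 3) : (-side T i + side T (i + 1) + side T (i + 2)) *
    (-side T i + side T (i + 1) - side T (i + 2)) * (-side T i - side T (i + 1) + side T (i + 2)) *
    (-(-side T i) + side T (i + 1) + side T (i + 2)) = 4 * doubleArea T ^ 2 := by
  -- The law of cosines, in the form `sin² = 1 - cos²`.
  calc _ = 4 * side T (i + 1) ^ 2 * side T (i + 2) ^ 2 -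
      (side T (i + 1) ^ 2 + side T (i + 2) ^ 2 - side T i ^ 2) ^ 2 := by ring
    _ = _ := by
      rw [side_sq_cyclic_one, side_sq_cyclic_two, side_sq T i, doubleArea_eq T i]
      simp only [cross, PiLp.sub_apply]
      ring

lemma isCircumellipse_iff (C : Ellipse) (i : Fin 3) : C.IsCircumellipse T ↔
    T.points i ∈ C.curve ∧ T.points (i + 1) ∈ C.curve ∧ T.points (i + 2) ∈ C.curve :=
  forall_fin_three_cyclic (p := fun j => T.points j ∈ C.curve) i

lemma prod_side (i : Fin 3) : ∏ j, side T j = side T i * side T (i + 1) * side T (i + 2) := by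
  rw [Fin.prod_univ_three]
  fin_cases i
  · rfl
  · change _ = side T 1 * side T 2 * side T 0; ring
  · change _ = side T 2 * side T 0 * side T 1; ring

lemma prod_side_pos : 0 < ∏ j, side T j := Finset.prod_pos fun i _ => side_pos T i

/-- Reversing the sign of one side only permutes the factors of Heron's product up to signs that
cancel, so the product is `4 D² > 0`. -/
theorem existsUnique_circumellipse_excenter (i : Fin 3) :
    (∃! C : Ellipse, C.center = excenter T i ∧ C.IsCircumellipse T) ∧
    ∀ C : Ellipse, C.center = excenter T i → C.IsCircumellipse T →
      C.area = Real.pi * (∏ j, side T j) / excess T i := by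
  have hN := excess_pos T i
  have hD := doubleArea_ne_zero T
  have hi := side_pos T i
  have hj := side_pos T (i + 1)
  have hk := side_pos T (i + 2)
  have hc := excess_mul_cross T i
  have hδ : cross (T.points (i + 1) - excenter T i) (T.points (i + 2) - excenter T i) ≠ 0 := by
    intro h
    rw [h, mul_zero] at hc
    exact mul_ne_zero (neg_ne_zero.2 hi.ne') hD hc.symm
  obtain ⟨h1, h2⟩ := existsUnique_circumellipse (neg_ne_zero.2 hi.ne') hj.ne' hk.ne'
    (excenter_relation T i) hδ (by rw [heron]; positivity)
  simp only [isCircumellipse_iff T _ i]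
  refine ⟨h1, fun C hC hT => ?_⟩
  have h3 := h2 C hC hT.1 hT.2.1 hT.2.2
  rw [heron] at h3
  have hdet : C.form.det = (excess T i / ∏ j, side T j) ^ 2 := by
    rw [div_pow, eq_div_iff (pow_ne_zero 2 (prod_side_pos T).ne'), prod_side T i]
    apply mul_left_cancel₀ (pow_ne_zero 2 hD)
    calc _ = C.form.det * (side T (i + 1) * side T (i + 2)) ^ 2 *
          (-side T i * doubleArea T) ^ 2 := by ring
      _ = excess T i ^ 2 * doubleArea T ^ 2 := by
        rw [← hc]; linear_combination excess T i ^ 2 / 4 * h3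
      _ = _ := by ring
  rw [C.area_eq, hdet, Real.sqrt_sq (div_nonneg hN.le (prod_side_pos T).le), div_div_eq_mul_div]

lemma excircleArea_eq (i : Fin 3) :
    excircleArea T i = Real.pi * (doubleArea T / excess T i) ^ 2 := by
  rw [excircleArea, Measure.real, EuclideanSpace.volume_closedBall_fin_two, ENNReal.toReal_mul,
    ENNReal.toReal_pow, ENNReal.toReal_ofReal (T.exradius_nonneg _),
    ENNReal.toReal_ofReal Real.pi_pos.le, exradius_eq, div_pow, sq_abs, div_pow, mul_comm]

/-- The circumradius is the product of the sides divided by four times the area. -/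
lemma circumradius_eq : T.circumradius = (∏ j, side T j) / (2 * |doubleArea T|) := by
  have hD := abs_pos.2 (doubleArea_ne_zero T)
  rw [eq_div_iff (by positivity)]
  have h : ∀ i, (T.points i 0 - T.circumcenter 0) ^ 2 + (T.points i 1 - T.circumcenter 1) ^ 2 =
      T.circumradius ^ 2 := fun i => by
    rw [← dist_sq, T.dist_circumcenter_eq_circumradius]
  refine (sq_eq_sq₀ (by have := T.circumradius_nonneg; positivity) (prod_side_pos T).le).1 ?_
  rw [mul_pow, mul_pow, sq_abs, prod_side T 0, mul_pow, mul_pow, side_sq, side_sq_cyclic_one,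
    side_sq_cyclic_two]
  have h0 := h 0
  have h1 := h 1
  have h2 := h 2
  simp only [doubleArea, cross, PiLp.sub_apply, zero_add]
  generalize T.circumradius ^ 2 = K at *
  obtain ⟨x, hx⟩ : ∃ x, x = T.points 0 0 - T.circumcenter 0 := ⟨_, rfl⟩
  obtain ⟨y, hy⟩ : ∃ y, y = T.points 0 1 - T.circumcenter 1 := ⟨_, rfl⟩
  obtain ⟨p, hp⟩ : ∃ p, p = T.points 1 0 - T.points 0 0 := ⟨_, rfl⟩
  obtain ⟨q, hq⟩ : ∃ q, q = T.points 1 1 - T.points 0 1 := ⟨_, rfl⟩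
  obtain ⟨r, hr⟩ : ∃ r, r = T.points 2 0 - T.points 0 0 := ⟨_, rfl⟩
  obtain ⟨s, hs⟩ : ∃ s, s = T.points 2 1 - T.points 0 1 := ⟨_, rfl⟩
  -- Equidistance from the circumcenter is linear after subtraction; Cramer's rule then gives `x`
  -- and `y`.
  have e1 : 2 * (x * p + y * q) = -(p ^ 2 + q ^ 2) := by
    rw [hx, hy, hp, hq]; linear_combination h1 - h0
  have e2 : 2 * (x * r + y * s) = -(r ^ 2 + s ^ 2) := by
    rw [hx, hy, hr, hs]; linear_combination h2 - h0
  have e3 : 2 * (p * s - q * r) * x = (r ^ 2 + s ^ 2) * q - (p ^ 2 + q ^ 2) * s := by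
    linear_combination s * e1 - q * e2
  have e4 : 2 * (p * s - q * r) * y = (p ^ 2 + q ^ 2) * r - (r ^ 2 + s ^ 2) * p := by
    linear_combination p * e2 - r * e1
  rw [← hp, ← hq, ← hr, ← hs, ← h0, ← hx, ← hy]
  have f1 : T.points 1 0 - T.points 2 0 = p - r := by rw [hp, hr]; ring
  have f2 : T.points 1 1 - T.points 2 1 = q - s := by rw [hq, hs]; ring
  have f3 : T.points 0 0 - T.points 1 0 = -p := by rw [hp]; ring
  have f4 : T.points 0 1 - T.points 1 1 = -q := by rw [hq]; ring
  rw [f1, f2, f3, f4]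
  calc _ = (2 * (p * s - q * r) * x) ^ 2 + (2 * (p * s - q * r) * y) ^ 2 := by ring
    _ = _ := by rw [e3, e4]; ring

theorem sum_area_div_excircleArea {C : Fin 3 → Ellipse}
    (hC : ∀ i, (C i).center = excenter T i ∧ (C i).IsCircumellipse T) :
    ∑ i, (C i).area / excircleArea T i =
      (∏ i, side T i) * (∑ i, side T i) / doubleArea T ^ 2 := by
  have hD := doubleArea_ne_zero T
  have h : ∀ i, (C i).area / excircleArea T i =
      (∏ i, side T i) / doubleArea T ^ 2 * excess T i := fun i => by
    have hN := (excess_pos T i).ne'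
    rw [(existsUnique_circumellipse_excenter T i).2 _ (hC i).1 (hC i).2, excircleArea_eq]
    field_simp
  simp only [h]
  rw [← Finset.mul_sum]
  have : ∑ i, excess T i = ∑ i, side T i := by
    simp only [Fin.sum_univ_three, excess]
    change (-side T 0 + side T 1 + side T 2) + (-side T 1 + side T 2 + side T 0) +
      (-side T 2 + side T 0 + side T 1) = _
    ring
  rw [this]; ring

theorem two_mul_circumradius_div_inradius : 2 * T.circumradius / T.inradius =
    (∏ i, side T i) * (∑ i, side T i) / doubleArea T ^ 2 := by
  have hD := abs_ne_zero.2 (doubleArea_ne_zero T)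
  have hL : ∑ i, side T i ≠ 0 :=
    (Finset.sum_pos (fun i _ => side_pos T i) Finset.univ_nonempty).ne'
  rw [circumradius_eq, inradius_eq, ← sq_abs (doubleArea T)]
  field_simp


/-! ### Chords tangent to a confocal ellipse -/

/-- A quadratic polynomial with exactly one root has zero discriminant. -/
lemma discrim_eq_zero_of_unique_root {α β γ t : ℝ} (hα : α ≠ 0)
    (ht : α * t ^ 2 + 2 * β * t + γ = 0)
    (hu : ∀ s, α * s ^ 2 + 2 * β * s + γ = 0 → s = t) : β ^ 2 = α * γ := by
  -- By Vieta this is the other root.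
  have h := hu (-2 * β / α - t) (by field_simp; linear_combination α * ht)
  have h' : β = -(α * t) := by
    have e : α * (-2 * β / α - t) = -2 * β - α * t := by field_simp
    rw [h] at e
    linear_combination e / 2
  rw [h'] at ht ⊢
  linear_combination -α * ht

/-- This is the dual equation of the ellipse at the line `PQ`: the discriminant of the ellipse's
equation restricted to the line vanishes. -/
lemma tangency {a b : ℝ} (ha : 0 < a) (hb : 0 < b) {P Q : Plane} (hPQ : P ≠ Q)
    (h : LineTangent P Q (axisEllipse a b)) :
    (P 0 * Q 1 - P 1 * Q 0) ^ 2 = b ^ 2 * (P 0 - Q 0) ^ 2 + a ^ 2 * (P 1 - Q 1) ^ 2 := by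
  obtain ⟨X, ⟨hX, hXS⟩, hu⟩ := h
  obtain ⟨t, rfl⟩ := mem_affineSpan_pair_iff_exists_lineMap_eq.1 hX
  have key : ∀ s : ℝ, AffineMap.lineMap P Q s ∈ axisEllipse a b ↔
      (b ^ 2 * (Q 0 - P 0) ^ 2 + a ^ 2 * (Q 1 - P 1) ^ 2) * s ^ 2 +
      2 * (b ^ 2 * P 0 * (Q 0 - P 0) + a ^ 2 * P 1 * (Q 1 - P 1)) * s +
      (b ^ 2 * P 0 ^ 2 + a ^ 2 * P 1 ^ 2 - a ^ 2 * b ^ 2) = 0 := fun s => by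
    simp only [axisEllipse, Set.mem_ofPred_eq, AffineMap.lineMap_apply, vsub_eq_sub, vadd_eq_add,
      PiLp.add_apply, PiLp.smul_apply, PiLp.sub_apply, smul_eq_mul]
    field_simp
    constructor <;> intro h <;> linear_combination h
  have hne : b ^ 2 * (Q 0 - P 0) ^ 2 + a ^ 2 * (Q 1 - P 1) ^ 2 ≠ 0 := by
    intro h0
    have h1 : 0 ≤ b ^ 2 * (Q 0 - P 0) ^ 2 := by positivity
    have h2 : 0 ≤ a ^ 2 * (Q 1 - P 1) ^ 2 := by positivity
    have h3 : (Q 0 - P 0) ^ 2 = 0 :=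
      (mul_eq_zero.1 (by linarith : b ^ 2 * (Q 0 - P 0) ^ 2 = 0)).resolve_left (by positivity)
    have h4 : (Q 1 - P 1) ^ 2 = 0 :=
      (mul_eq_zero.1 (by linarith : a ^ 2 * (Q 1 - P 1) ^ 2 = 0)).resolve_left (by positivity)
    apply hPQ
    ext i
    fin_cases i
    · exact (sub_eq_zero.1 (pow_eq_zero_iff two_ne_zero |>.1 h3)).symm
    · exact (sub_eq_zero.1 (pow_eq_zero_iff two_ne_zero |>.1 h4)).symm
  have hd := discrim_eq_zero_of_unique_root hne ((key t).1 hXS) fun s hs => by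
    have h5 := hu _ ⟨AffineMap.lineMap_mem_affineSpan_pair s P Q, (key s).2 hs⟩
    exact AffineMap.lineMap_injective ℝ hPQ h5
  have : a ^ 2 * b ^ 2 ≠ 0 := by positivity
  apply mul_left_cancel₀ this
  linear_combination -hd

/-- For points at angles `θ` and `φ` the factors are `1 - cos (θ - φ)` and `1 - cos (θ + φ)`. -/
lemma sq_sub_unit_circle_fst {x y z w : ℝ} (h1 : x ^ 2 + y ^ 2 = 1) (h2 : z ^ 2 + w ^ 2 = 1) :
    (x - z) ^ 2 = (1 - (x * z + y * w)) * (1 - (x * z - y * w)) := by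
  linear_combination (1 - z ^ 2) * h1 + y ^ 2 * h2

lemma sq_sub_unit_circle_snd {x y z w : ℝ} (h1 : x ^ 2 + y ^ 2 = 1) (h2 : z ^ 2 + w ^ 2 = 1) :
    (y - w) ^ 2 = (1 - (x * z + y * w)) * (1 + (x * z - y * w)) := by
  linear_combination (1 - w ^ 2) * h1 + x ^ 2 * h2

/-- The relation between the normalized coordinates of the ends of a chord of an ellipse that is
tangent to a confocal one. -/
lemma chord_relation {A B l x y z w : ℝ} (h1 : x ^ 2 + y ^ 2 = 1) (h2 : z ^ 2 + w ^ 2 = 1)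
    (hne : x * z + y * w ≠ 1)
    (ht : A * B * (x * w - y * z) ^ 2 =
      (B - l) * A * (x - z) ^ 2 + (A - l) * B * (y - w) ^ 2) :
    A * B * (1 + (x * z + y * w)) =
      (B - l) * A * (1 - (x * z - y * w)) + (A - l) * B * (1 + (x * z - y * w)) := by
  have e1 : (x * w - y * z) ^ 2 = (1 - (x * z + y * w)) * (1 + (x * z + y * w)) := by
    linear_combination (z ^ 2 + w ^ 2) * h1 + h2
  have e2 : (x - z) ^ 2 = (1 - (x * z + y * w)) * (1 - (x * z - y * w)) := sq_sub_unit_circle_fst h1 h2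
  have e3 : (y - w) ^ 2 = (1 - (x * z + y * w)) * (1 + (x * z - y * w)) := sq_sub_unit_circle_snd h1 h2
  rw [e1, e2, e3] at ht
  -- Every term of the tangency equation carries the factor `1 - (x z + y w)`, nonzero for distinct
  -- ends.
  apply mul_left_cancel₀ (sub_ne_zero.2 hne.symm)
  linear_combination ht

/-! ### The closing condition -/

/-- The closing condition for three points of the unit circle that are pairwise conjugate with
respect to the conic `(1 + m) X² + (1 - m) Y² = c`. -/
lemma closing {m c x₀ y₀ x₁ y₁ x₂ y₂ : ℝ} (h0 : x₀ ^ 2 + y₀ ^ 2 = 1) (h1 : x₁ ^ 2 + y₁ ^ 2 = 1)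
    (h2 : x₂ ^ 2 + y₂ ^ 2 = 1) (hne : x₁ * x₂ + y₁ * y₂ ≠ 1)
    (h01 : (1 + m) * x₀ * x₁ + (1 - m) * y₀ * y₁ = c)
    (h02 : (1 + m) * x₀ * x₂ + (1 - m) * y₀ * y₂ = c)
    (h12 : (1 + m) * x₁ * x₂ + (1 - m) * y₁ * y₂ = c)
    (hd : 0 < 1 - c + m * (x₀ ^ 2 - y₀ ^ 2)) :
    x₀ * x₁ + y₀ * y₁ + (x₀ * x₂ + y₀ * y₂) + (x₁ * x₂ + y₁ * y₂) = c - 1 := by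
  obtain ⟨n₁, hn₁⟩ : ∃ n₁, n₁ = (1 + m) * x₀ := ⟨_, rfl⟩
  obtain ⟨n₂, hn₂⟩ : ∃ n₂, n₂ = (1 - m) * y₀ := ⟨_, rfl⟩
  obtain ⟨u, hu⟩ : ∃ u, u = m * (x₀ ^ 2 - y₀ ^ 2) := ⟨_, rfl⟩
  obtain ⟨g, hg⟩ : ∃ g, g = x₁ * x₂ + y₁ * y₂ := ⟨_, rfl⟩
  obtain ⟨M, hM⟩ : ∃ M, M = n₁ ^ 2 + n₂ ^ 2 := ⟨_, rfl⟩
  rw [← hn₁, ← hn₂] at h01 h02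
  rw [← hg] at hne
  rw [← hu] at hd
  have hMu : M = 1 + m ^ 2 + 2 * u := by
    rw [hM, hn₁, hn₂, hu]; linear_combination (1 + m ^ 2) * h0
  have hM0 : M ≠ 0 := by
    intro h
    have e1 : n₁ = 0 := by nlinarith [sq_nonneg n₁, sq_nonneg n₂]
    have e2 : n₂ = 0 := by nlinarith [sq_nonneg n₁, sq_nonneg n₂]
    rw [e1, e2] at h01
    have e3 : u = -1 := by
      rw [hu]; linear_combination -h0 - x₀ * (hn₁ - e1) - y₀ * (hn₂ - e2)
    linarith
  -- The second and third points lie on the line `n · X = c`, the polar of the first. Their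
  -- difference is orthogonal both to `n` and to their sum, so the sum is parallel to `n`.
  have hcross : n₂ * (x₁ + x₂) - n₁ * (y₁ + y₂) = 0 := by
    have hx : (n₂ * (x₁ + x₂) - n₁ * (y₁ + y₂)) * (x₁ - x₂) = 0 := by
      linear_combination n₂ * h1 - n₂ * h2 - (y₁ + y₂) * (h01 - h02)
    have hy : (n₂ * (x₁ + x₂) - n₁ * (y₁ + y₂)) * (y₁ - y₂) = 0 := by
      linear_combination -n₁ * h1 + n₁ * h2 + (x₁ + x₂) * (h01 - h02)
    by_contra h
    have hx' := (mul_eq_zero.1 hx).resolve_left h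
    have hy' := (mul_eq_zero.1 hy).resolve_left h
    apply hne
    rw [hg]
    linear_combination h1 - x₁ * hx' - y₁ * hy'
  have hsx : M * (x₁ + x₂) = 2 * c * n₁ := by
    rw [hM]; linear_combination n₁ * (h01 + h02) + n₂ * hcross
  have hsy : M * (y₁ + y₂) = 2 * c * n₂ := by
    rw [hM]; linear_combination n₂ * (h01 + h02) - n₁ * hcross
  have hMg : M * (1 + g) = 2 * c ^ 2 := by
    apply mul_left_cancel₀ (mul_ne_zero two_ne_zero hM0)
    calc _ = (M * (x₁ + x₂)) ^ 2 + (M * (y₁ + y₂)) ^ 2 := by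
          rw [hg]; linear_combination -M ^ 2 * (h1 + h2)
      _ = 4 * c ^ 2 * (n₁ ^ 2 + n₂ ^ 2) := by rw [hsx, hsy]; ring
      _ = _ := by rw [← hM]; ring
  obtain ⟨k, hk⟩ : ∃ k, k = n₁ * (y₁ - y₂) - n₂ * (x₁ - x₂) := ⟨_, rfl⟩
  have hdx : M * (x₁ - x₂) = -(n₂ * k) := by
    rw [hM, hk]; linear_combination n₁ * (h01 - h02)
  have hdy : M * (y₁ - y₂) = n₁ * k := by
    rw [hM, hk]; linear_combination n₂ * (h01 - h02)
  have hk2 : k ^ 2 = M * (2 - 2 * g) := by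
    apply mul_left_cancel₀ hM0
    calc _ = (-(n₂ * k)) ^ 2 + (n₁ * k) ^ 2 := by rw [hM]; ring
      _ = (M * (x₁ - x₂)) ^ 2 + (M * (y₁ - y₂)) ^ 2 := by rw [hdx, hdy]
      _ = _ := by rw [hg]; linear_combination M ^ 2 * (h1 + h2)
  have hdiff : M * (x₁ * x₂ - y₁ * y₂) = n₁ ^ 2 - n₂ ^ 2 := by
    apply mul_left_cancel₀ (mul_ne_zero four_ne_zero hM0)
    calc _ = (M * (x₁ + x₂)) ^ 2 - (M * (y₁ + y₂)) ^ 2 - ((M * (x₁ - x₂)) ^ 2 -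
          (M * (y₁ - y₂)) ^ 2) := by ring
      _ = (n₁ ^ 2 - n₂ ^ 2) * (4 * c ^ 2 + k ^ 2) := by rw [hsx, hsy, hdx, hdy]; ring
      _ = _ := by rw [hk2]; linear_combination (-2 * (n₁ ^ 2 - n₂ ^ 2)) * hMg
  have hn : m * (n₁ ^ 2 - n₂ ^ 2) = (1 + m ^ 2) * u + 2 * m ^ 2 := by
    rw [hn₁, hn₂, hu]; linear_combination 2 * m ^ 2 * h0
  -- Conjugacy of the second and third points yields Cayley's condition times `1 - c + u`. That
  -- factor vanishes only if the first point lies on the conic, which `hd` excludes.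
  have hcayley : m ^ 2 = 1 + 2 * c := by
    have : (m ^ 2 - (1 + 2 * c)) * (1 - c + u) = 0 := by
      have e : M * (g + m * (x₁ * x₂ - y₁ * y₂)) = M * c := by
        rw [hg]; linear_combination M * h12
      linear_combination e - hMg - m * hdiff + (1 + c) * hMu - hn
    exact sub_eq_zero.1 ((mul_eq_zero.1 this).resolve_right hd.ne')
  have hS : M * (x₀ * x₁ + y₀ * y₁ + (x₀ * x₂ + y₀ * y₂)) = 2 * c * (1 + u) := by
    have e : n₁ * x₀ + n₂ * y₀ = 1 + u := by rw [hn₁, hn₂, hu]; linear_combination h0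
    linear_combination x₀ * hsx + y₀ * hsy + 2 * c * e
  apply mul_left_cancel₀ hM0
  rw [← hg]
  linear_combination hS + hMg - c * hMu - c * hcayley

/-- The data of a chord of an ellipse tangent to a confocal one, in normalized coordinates. -/
lemma chord_data {a b a' b' : ℝ} (ha : 0 < a) (hb : 0 < b) (ha' : 0 < a') (hb' : 0 < b')
    (hconf : a ^ 2 - b ^ 2 = a' ^ 2 - b' ^ 2) {P Q : Plane} (hP : P ∈ axisEllipse a b)
    (hQ : Q ∈ axisEllipse a b) (hPQ : P ≠ Q) (ht : LineTangent P Q (axisEllipse a' b')) :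
    P 0 / a * (Q 0 / a) + P 1 / b * (Q 1 / b) < 1 ∧
    (1 + ((a ^ 2 - a' ^ 2) / a ^ 2 - (a ^ 2 - a' ^ 2) / b ^ 2)) * (P 0 / a) * (Q 0 / a) +
      (1 - ((a ^ 2 - a' ^ 2) / a ^ 2 - (a ^ 2 - a' ^ 2) / b ^ 2)) * (P 1 / b) * (Q 1 / b) =
      1 - (a ^ 2 - a' ^ 2) / a ^ 2 - (a ^ 2 - a' ^ 2) / b ^ 2 ∧
    (a ^ 2 - a' ^ 2) * dist P Q ^ 2 =
      (a * b * (1 - (P 0 / a * (Q 0 / a) + P 1 / b * (Q 1 / b)))) ^ 2 := by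
  have ht' := tangency ha' hb' hPQ ht
  obtain ⟨x, hx⟩ : ∃ x, x = P 0 / a := ⟨_, rfl⟩
  obtain ⟨y, hy⟩ : ∃ y, y = P 1 / b := ⟨_, rfl⟩
  obtain ⟨z, hz⟩ : ∃ z, z = Q 0 / a := ⟨_, rfl⟩
  obtain ⟨w, hw⟩ : ∃ w, w = Q 1 / b := ⟨_, rfl⟩
  have hP0 : P 0 = a * x := by rw [hx]; field_simp
  have hP1 : P 1 = b * y := by rw [hy]; field_simp
  have hQ0 : Q 0 = a * z := by rw [hz]; field_simp
  have hQ1 : Q 1 = b * w := by rw [hw]; field_simp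
  have h1 : x ^ 2 + y ^ 2 = 1 := by rw [hx, hy, div_pow, div_pow]; exact hP
  have h2 : z ^ 2 + w ^ 2 = 1 := by rw [hz, hw, div_pow, div_pow]; exact hQ
  have hlt : x * z + y * w < 1 := by
    have h : (x - z) ^ 2 + (y - w) ^ 2 = 2 * (1 - (x * z + y * w)) := by
      linear_combination h1 + h2
    by_contra! hge
    have e1 : x = z := by nlinarith [sq_nonneg (x - z), sq_nonneg (y - w)]
    have e2 : y = w := by nlinarith [sq_nonneg (x - z), sq_nonneg (y - w)]
    apply hPQ
    ext i
    fin_cases i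
    · exact hP0.trans ((congrArg _ e1).trans hQ0.symm)
    · exact hP1.trans ((congrArg _ e2).trans hQ1.symm)
  rw [dist_sq, ← hx, ← hy, ← hz, ← hw]
  rw [hP0, hP1, hQ0, hQ1] at ht' ⊢
  have hrel := chord_relation (A := a ^ 2) (B := b ^ 2) (l := a ^ 2 - a' ^ 2) h1 h2 hlt.ne
    (by linear_combination ht' + a ^ 2 * (x - z) ^ 2 * hconf)
  refine ⟨hlt, ?_, ?_⟩
  · field_simp
    linear_combination hrel
  · have e2 : (x - z) ^ 2 = (1 - (x * z + y * w)) * (1 - (x * z - y * w)) := sq_sub_unit_circle_fst h1 h2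
    have e3 : (y - w) ^ 2 = (1 - (x * z + y * w)) * (1 + (x * z - y * w)) := sq_sub_unit_circle_snd h1 h2
    -- `hrel` turns the factor `a² (1 - (x z - y w)) + b² (1 + (x z - y w))` of the squared length
    -- into `a² b² (1 - (x z + y w)) / l`, with `l = a² - a'²`.
    linear_combination (a ^ 2 - a' ^ 2) * a ^ 2 * e2 + (a ^ 2 - a' ^ 2) * b ^ 2 * e3 +
      (1 - (x * z + y * w)) * hrel

/-- Area of a triangle inscribed in the unit circle. -/
lemma area_unit_circle {x₀ y₀ x₁ y₁ x₂ y₂ : ℝ} (h0 : x₀ ^ 2 + y₀ ^ 2 = 1)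
    (h1 : x₁ ^ 2 + y₁ ^ 2 = 1) (h2 : x₂ ^ 2 + y₂ ^ 2 = 1) :
    ((x₁ - x₀) * (y₂ - y₀) - (y₁ - y₀) * (x₂ - x₀)) ^ 2 =
      2 * ((1 - (x₁ * x₂ + y₁ * y₂)) * (1 - (x₀ * x₂ + y₀ * y₂)) *
        (1 - (x₀ * x₁ + y₀ * y₁))) := by
  obtain ⟨d₀, hd₀⟩ : ∃ d, d = x₀ ^ 2 + y₀ ^ 2 - 1 := ⟨_, rfl⟩
  obtain ⟨d₁, hd₁⟩ : ∃ d, d = x₁ ^ 2 + y₁ ^ 2 - 1 := ⟨_, rfl⟩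
  obtain ⟨d₂, hd₂⟩ : ∃ d, d = x₂ ^ 2 + y₂ ^ 2 - 1 := ⟨_, rfl⟩
  -- A polynomial identity with no constraint on the points; the defects `d₀`, `d₁`, `d₂` vanish on
  -- the circle.
  have h : ((x₁ - x₀) * (y₂ - y₀) - (y₁ - y₀) * (x₂ - x₀)) ^ 2 =
      2 * ((1 - (x₁ * x₂ + y₁ * y₂)) * (1 - (x₀ * x₂ + y₀ * y₂)) *
        (1 - (x₀ * x₁ + y₀ * y₁))) - d₀ * d₁ * d₂ + d₀ * (1 - (x₁ * x₂ + y₁ * y₂)) ^ 2 +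
        d₁ * (1 - (x₀ * x₂ + y₀ * y₂)) ^ 2 + d₂ * (1 - (x₀ * x₁ + y₀ * y₁)) ^ 2 := by
    rw [hd₀, hd₁, hd₂]; ring
  rw [h, hd₀, hd₁, hd₂, h0, h1, h2]; ring

/-! ### Invariance over the family -/

theorem sum_ratio_invariant {a b a' b' : ℝ} (hb : 0 < b) (hab : b ≤ a)
    (ha' : 0 < a') (hb' : 0 < b') (hinner : a' < a) (hconf : a ^ 2 - b ^ 2 = a' ^ 2 - b' ^ 2)
    {T : Affine.Triangle ℝ Plane} (hT : IsInterscribed T (axisEllipse a b) (axisEllipse a' b')) :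
    (∏ i, side T i) * (∑ i, side T i) / doubleArea T ^ 2 = a ^ 2 * b ^ 2 *
      (3 + (a ^ 2 - a' ^ 2) / a ^ 2 + (a ^ 2 - a' ^ 2) / b ^ 2) / (2 * (a ^ 2 - a' ^ 2) ^ 2) := by
  have ha : 0 < a := hb.trans_le hab
  have hl : 0 < a ^ 2 - a' ^ 2 := by nlinarith
  have data := fun i j (h : i ≠ j) => chord_data ha hb ha' hb' hconf (hT.1 i) (hT.1 j)
    (T.independent.injective.ne h) (hT.2 i j h)
  have circ : ∀ i, (T.points i 0 / a) ^ 2 + (T.points i 1 / b) ^ 2 = 1 := fun i => by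
    rw [div_pow, div_pow]; exact hT.1 i
  obtain ⟨p01, r01, s01⟩ := data 0 1 (by decide)
  obtain ⟨p02, r02, s02⟩ := data 0 2 (by decide)
  obtain ⟨p12, r12, s12⟩ := data 1 2 (by decide)
  have hD : doubleArea T = a * b * ((T.points 1 0 / a - T.points 0 0 / a) *
      (T.points 2 1 / b - T.points 0 1 / b) - (T.points 1 1 / b - T.points 0 1 / b) *
      (T.points 2 0 / a - T.points 0 0 / a)) := by
    simp only [doubleArea, cross, PiLp.sub_apply]
    field_simp
  have hS : ∀ P Q : Plane, ∀ g : ℝ, g < 1 →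
      (a ^ 2 - a' ^ 2) * dist P Q ^ 2 = (a * b * (1 - g)) ^ 2 →
      dist P Q = a * b / √(a ^ 2 - a' ^ 2) * (1 - g) := fun P Q g hg h => by
    have hs := Real.sqrt_pos.2 hl
    have hg' : 0 < 1 - g := sub_pos.2 hg
    rw [div_mul_eq_mul_div, eq_div_iff hs.ne']
    refine (sq_eq_sq₀ (by positivity) (by positivity)).1 ?_
    rw [mul_pow, Real.sq_sqrt hl.le, mul_comm, h]
  have hs0 : side T 0 = _ := hS _ _ _ p12 s12
  have hs1 : side T 1 = _ := (dist_comm _ _).trans (hS _ _ _ p02 s02)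
  have hs2 : side T 2 = _ := hS _ _ _ p01 s01
  have hA := area_unit_circle (circ 0) (circ 1) (circ 2)
  -- With `α = l / a²` and `β = l / b²`, where `l = a² - a'²`, the quantity is `2 (α x² + β y²)` at
  -- a point `(x, y)` of the unit circle.
  have hd : 0 < 1 - (1 - (a ^ 2 - a' ^ 2) / a ^ 2 - (a ^ 2 - a' ^ 2) / b ^ 2) +
      ((a ^ 2 - a' ^ 2) / a ^ 2 - (a ^ 2 - a' ^ 2) / b ^ 2) *
        ((T.points 0 0 / a) ^ 2 - (T.points 0 1 / b) ^ 2) := by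
    have hα : 0 < (a ^ 2 - a' ^ 2) / a ^ 2 := by positivity
    have hβ : 0 < (a ^ 2 - a' ^ 2) / b ^ 2 := by positivity
    have hc := circ 0
    generalize (a ^ 2 - a' ^ 2) / a ^ 2 = α at *
    generalize (a ^ 2 - a' ^ 2) / b ^ 2 = β at *
    have h2 : (1 : ℝ) - (1 - α - β) + (α - β) * ((T.points 0 0 / a) ^ 2 - (T.points 0 1 / b) ^ 2) =
        2 * (α * (T.points 0 0 / a) ^ 2 + β * (T.points 0 1 / b) ^ 2) := by
      linear_combination -(α + β) * hc
    rw [h2]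
    rcases (sq_nonneg (T.points 0 0 / a)).lt_or_eq with h | h
    · have := mul_pos hα h
      have := mul_nonneg hβ.le (sq_nonneg (T.points 0 1 / b))
      linarith
    · rw [← h, zero_add] at hc
      rw [← h, hc]
      linarith
  have hcl := closing (circ 0) (circ 1) (circ 2) p12.ne r01 r02 r12 hd
  rw [hD, mul_pow, hA, Fin.prod_univ_three, Fin.sum_univ_three, hs0, hs1, hs2]
  have q01 := (sub_pos.2 p01).ne'
  have q02 := (sub_pos.2 p02).ne'
  have q12 := (sub_pos.2 p12).ne'
  generalize T.points 0 0 / a * (T.points 1 0 / a) + T.points 0 1 / b * (T.points 1 1 / b) = g at *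
  generalize T.points 0 0 / a * (T.points 2 0 / a) + T.points 0 1 / b * (T.points 2 1 / b) = h at *
  generalize T.points 1 0 / a * (T.points 2 0 / a) + T.points 1 1 / b * (T.points 2 1 / b) = k at *
  have hk4 : (a * b / √(a ^ 2 - a' ^ 2)) ^ 4 = a ^ 4 * b ^ 4 / (a ^ 2 - a' ^ 2) ^ 2 := by
    rw [div_pow, mul_pow, show √(a ^ 2 - a' ^ 2) ^ 4 = (√(a ^ 2 - a' ^ 2) ^ 2) ^ 2 by ring,
      Real.sq_sqrt hl.le]
  generalize a * b / √(a ^ 2 - a' ^ 2) = κ at *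
  -- The closing sum is `c - 1` with `c = 1 - l / a² - l / b²`, where `l = a² - a'²`.
  have hsum : (1 - k) + (1 - h) + (1 - g) =
      3 + (a ^ 2 - a' ^ 2) / a ^ 2 + (a ^ 2 - a' ^ 2) / b ^ 2 := by linear_combination -hcl
  rw [← hsum]
  calc _ = κ ^ 4 * ((1 - k) * (1 - h) * (1 - g)) * ((1 - k) + (1 - h) + (1 - g)) /
        ((a * b) ^ 2 * (2 * ((1 - k) * (1 - h) * (1 - g)))) := by congr 1; ring
    _ = _ := by
      rw [hk4]
      field_simp

end PonceletConfocal

theorem mainTheorem4 (a b a' b' : ℝ) (hb : 0 < b) (hab : b ≤ a)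
    (ha' : 0 < a') (hb' : 0 < b') (hinner : a' < a)
    (hconfocal : a ^ 2 - b ^ 2 = a' ^ 2 - b' ^ 2) :
    ∃ k : ℝ, ∀ T : Affine.Triangle ℝ PonceletConfocal.Plane,
      PonceletConfocal.IsInterscribed T
        (PonceletConfocal.axisEllipse a b) (PonceletConfocal.axisEllipse a' b') →
      (∀ i : Fin 3, ∃! C : PonceletConfocal.Ellipse,
        C.center = PonceletConfocal.excenter T i ∧ C.IsCircumellipse T) ∧
      ∀ C : Fin 3 → PonceletConfocal.Ellipse,
        (∀ i, (C i).center = PonceletConfocal.excenter T i ∧ (C i).IsCircumellipse T) →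
        ∑ i, (C i).area / PonceletConfocal.excircleArea T i = k ∧
        ∑ i, (C i).area / PonceletConfocal.excircleArea T i = 2 / PonceletConfocal.rho T ∧
        ∑ i, (C i).area / PonceletConfocal.excircleArea T i =
          2 * Affine.Simplex.circumradius T / Affine.Simplex.inradius T := by
  refine ⟨a ^ 2 * b ^ 2 * (3 + (a ^ 2 - a' ^ 2) / a ^ 2 + (a ^ 2 - a' ^ 2) / b ^ 2) /
    (2 * (a ^ 2 - a' ^ 2) ^ 2), fun T hT => ⟨fun i => (PonceletConfocal.existsUnique_circumellipse_excenter T i).1,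
    fun C hC => ?_⟩⟩
  have h := PonceletConfocal.sum_area_div_excircleArea T hC
  refine ⟨h.trans (PonceletConfocal.sum_ratio_invariant hb hab ha' hb' hinner hconfocal hT), ?_,
    h.trans (PonceletConfocal.two_mul_circumradius_div_inradius T).symm⟩
  rw [h, ← PonceletConfocal.two_mul_circumradius_div_inradius, PonceletConfocal.rho,
    div_div_eq_mul_div]
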